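/- **Conventions.** An $\omega$-quasi-Borel space ($\omega$qbs) is a set $|X|$ with a partial order in which every $\omega$-chain has a least upper bound (an $\omega$-cpo), and a set $M_X$ of functions $\mathbb R\to |X|$ (random elements) that contains the constants and is closed under precomposition with Borel maps $\mathbb R\to\mathbb R$, under gluing along countable Borel partitions of $\mathbb R$, and under pointwise lubs of $\omega$-chains. Morphisms are the Scott-continuous functions (monotone, preserving lubs of $\omega$-chains) that map random elements to random elements; this is the Cartesian closed category $\omega\mathbf{Qbs}$. Products are componentwise; $Y^X$ has the morphisms $X\to Y$ as elements, ordered pointwise, and the curryings of morphisms $\mathbb R\times X\to Y$ as random elements. Here $\mathbb R$ carries the discrete order and the Borel functions as random elements, and $W=[0,\infty]$ carries the usual order and the Borel functions. The lifting $X_\bot=|X|+\{\bot\}$ has $\bot$ as least element; its random elements are the $f:\mathbb R\to X_\bot$ whose domain $\{f\ne\bot\}$ is Borel and which, if the domain is non-empty, agree on it with some element of $M_X$. A *strong monad structure* on $\omega\mathbf{Qbs}$ assigns to every object $X$ an object $SX$ and a morphism $\mathrm{return}_X: X\to SX$, and to all $X,Y$ a morphism ${\gg\!\!=}: SX\times (SY)^X\to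 SY$; it is a *strong monad* if $(\mathrm{return}\,x\gg\!\!=f)=f(x)$, $(a\gg\!\!=\mathrm{return})=a$ and $((a\gg\!\!=f)\gg\!\!=g)=(a\gg\!\!=\lambda x.\,f(x)\gg\!\!=g)$. A family of morphisms $h_X:SX\to S'X$ *preserves* the structures if $h(\mathrm{return}\,x)=\mathrm{return}\,x$ and $h(a\gg\!\!=f)=(h(a)\gg\!\!=h\circ f)$. * $JX=W^{W^X}$, with $\mathrm{return}\,x=\lambda w.\,w(x)$ and $(\mu\gg\!\!=f)=\lambda w.\,\mu(\lambda x.\,f(x)(w))$. * $RX=(X_\bot)^{\mathbb R}$. For a measurable partial function $\varphi:\mathbb R\rightharpoonup\mathbb R\times\mathbb R$ that pushes Lebesgue measure on $\mathbb R$ forward to Lebesgue measure on $\mathbb R^2$, $R$ has the structure in which $\mathrm{return}\,x$ is defined exactly on $[0,1]$ with constant value $x$, and $(\alpha\gg\!\!=f)(r)=f(\alpha(t))(s)$ where $\varphi(r)=(s,t)$, undefined ($=\bot$) whenever $\varphi(r)$, $\alpha(t)$ or $f(\alpha(t))(s)$ is. * $\mathbb E: RX\to JX$, $\mathbb E_\alpha[w]=\int_{\{\alpha\neq\bot\}}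 w(\alpha(r))\,dr$ (Lebesgue). * $TX$: $|TX|\subseteq|JX|$ is the smallest set containing all $\mathbb E_\alpha$, $\alpha\in RX$, and closed under lubs of $\omega$-chains, with the order of $JX$; $M_{TX}$ is the smallest set of functions containing all $\mathbb E\circ A$, $A\in M_{RX}$, and closed under pointwise lubs of $\omega$-chains. A *full mono* is an order-reflecting morphism. A *densely strong epi* is a morphism $e:X\to Y$ such that $M_Y$ is the closure of $\{e\circ\alpha:\alpha\in M_X\}$ under pointwise lubs of $\omega$-chains. **Theorem.** 1. For every $\omega$qbs $X$, the expectation map factors as $\mathbb E=m_X\circ e_X$, where the corestriction $e_X:RX\to TX$ is a densely strong epi and the inclusion $m_X:TX\to JX$ is a full mono. 2. The unit and bind of $J$ restrict to $T$: there is exactly one strong monad structure on $T$ that the inclusions $m_X$ preserve (into $J$), and it is a strong monad. 3. Maps $\varphi$ as above exist, and for every such $\varphi$ the maps $e_X:RX\to TX$ preserve the structure of $R$ given by $\varphi$ and the structure of $T$ in (2). -/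

import Mathlib

open MeasureTheory OmegaCompletePartialOrder
open scoped ENNReal

universe u v w

/-- The `ω`-chain-lub closure of `S`: the smallest set containing `S` and closed under lubs of
`ω`-chains. -/
inductive OmegaLubClosure {α : Type u} [OmegaCompletePartialOrder α] (S : Set α) : α → Prop
  | basic (a : α) : a ∈ S → OmegaLubClosure S a
  | lub (c : Chain α) : (∀ n, OmegaLubClosure S (c n)) → OmegaLubClosure S (ωSup c)

/-- The discrete partial order on a type. -/
@[reducible]
def discreteOrder (α : Type u) : PartialOrder α where
  le := Eq
  le_refl := Eq.refl
  le_trans _ _ _ := Eq.trans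
  le_antisymm _ _ h _ := h

/-- The discrete `ω`-cpo on a type, ordered by equality. -/
@[reducible]
def discreteOmegaCPO (α : Type u) : OmegaCompletePartialOrder α :=
  letI := discreteOrder α
  { ωSup := fun c => c 0
    le_ωSup := fun c i => (c.monotone (Nat.zero_le i)).symm
    ωSup_le := fun _ _ h => h 0 }

/-- An `ω`-quasi-Borel space: an `ω`-cpo together with a set of random elements containing the
constants, closed under precomposition with Borel functions, under gluing along a countable Borel
partition (the partition `U n = p ⁻¹' {n}` is given by a Borel function `p : ℝ → ℕ`), and under
pointwise lubs of `ω`-chains. -/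
structure OmegaQbs where
  carrier : Type u
  order : OmegaCompletePartialOrder carrier
  rand : Set (ℝ → carrier)
  const_mem : ∀ x : carrier, (fun _ => x) ∈ rand
  comp_mem : ∀ α ∈ rand, ∀ g : ℝ → ℝ, Measurable g → (fun r => α (g r)) ∈ rand
  glue_mem : ∀ (p : ℝ → ℕ) (α : ℕ → ℝ → carrier), Measurable p → (∀ n, α n ∈ rand) →
    (fun r => α (p r) r) ∈ rand
  lub_mem : ∀ c : Chain (ℝ → carrier), (∀ n, c n ∈ rand) → ωSup c ∈ rand

namespace OmegaQbs

instance : CoeSort OmegaQbs.{u} (Type u) := ⟨OmegaQbs.carrier⟩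

instance instOrder (X : OmegaQbs.{u}) : OmegaCompletePartialOrder X := X.order

/-- Morphisms: Scott-continuous functions that preserve random elements. -/
structure Hom (X : OmegaQbs.{u}) (Y : OmegaQbs.{v}) extends ContinuousHom X Y where
  map_rand : ∀ α ∈ X.rand, (fun r => toFun (α r)) ∈ Y.rand

instance (X : OmegaQbs.{u}) (Y : OmegaQbs.{v}) : FunLike (Hom X Y) X Y where
  coe f := f.toFun
  coe_injective := by
    rintro ⟨f, _⟩ ⟨g, _⟩ h
    have : f = g := DFunLike.ext' h
    subst this
    rfl

variable {X : OmegaQbs.{u}} {Y : OmegaQbs.{v}} {Z : OmegaQbs.{w}}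

@[ext]
theorem Hom.ext {f g : Hom X Y} (h : ∀ x, f x = g x) : f = g := DFunLike.ext f g h

theorem Hom.cont (f : Hom X Y) : ωScottContinuous (fun x => f x) :=
  f.toContinuousHom.ωScottContinuous

theorem Hom.mono (f : Hom X Y) : Monotone (fun x => f x) := f.cont.monotone

theorem Hom.rand (f : Hom X Y) {α : ℝ → X} (h : α ∈ X.rand) : (fun r => f (α r)) ∈ Y.rand :=
  f.map_rand α h

/-- Morphisms from functions. -/
def mkHom (f : X → Y) (hc : ωScottContinuous f) (hr : ∀ α ∈ X.rand, (fun r => f (α r)) ∈ Y.rand) :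
    Hom X Y where
  toContinuousHom := ContinuousHom.ofFun f hc
  map_rand := hr

@[simp]
theorem mkHom_apply (f : X → Y) (hc) (hr) (x : X) : mkHom f hc hr x = f x := rfl

theorem continuous_of_le {α : Type u} {β : Type v} [OmegaCompletePartialOrder α]
    [OmegaCompletePartialOrder β] {f : α → β} (hm : Monotone f)
    (h : ∀ (c : Chain α) (b : β), (∀ n, f (c n) ≤ b) → f (ωSup c) ≤ b) : ωScottContinuous f :=
  ωScottContinuous.of_monotone_map_ωSup ⟨hm, fun c => le_antisymm
    (h c _ fun n => le_ωSup (c.map ⟨f, hm⟩) n)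
    (ωSup_le _ _ fun n => hm (le_ωSup c n))⟩

theorem le_of_continuous {α : Type u} {β : Type v} [OmegaCompletePartialOrder α]
    [OmegaCompletePartialOrder β] {f : α → β} (hf : ωScottContinuous f) (c : Chain α) (b : β)
    (h : ∀ n, f (c n) ≤ b) : f (ωSup c) ≤ b := by
  rw [hf.map_ωSup]
  exact ωSup_le _ _ h

/-! ### The hom-sets as `ω`-cpos, ordered pointwise -/

instance : PartialOrder (Hom X Y) := PartialOrder.lift (fun f => (f : X → Y)) DFunLike.coe_injective

theorem Hom.le_def {f g : Hom X Y} : f ≤ g ↔ ∀ x, f x ≤ g x := Iff.rfl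

/-- The chain of values at a point. -/
def evalChain (c : Chain (Hom X Y)) (x : X) : Chain Y :=
  c.map ⟨fun f => f x, fun _ _ h => h x⟩

/-- The lub of a chain of morphisms, computed pointwise. -/
def homSup (c : Chain (Hom X Y)) : Hom X Y :=
  mkHom (fun x => ωSup (evalChain c x))
    (continuous_of_le (fun x y h => ωSup_le _ _ fun n =>
        le_ωSup_of_le (c := evalChain c y) n ((c n).mono h))
      (fun d b h => ωSup_le _ _ fun n => le_of_continuous (c n).cont d b fun m =>
        le_trans (le_ωSup (evalChain c (d m)) n) (h m)))
    (fun α hα => Y.lub_mem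
      (c.map ⟨fun f r => f (α r), fun _ _ h r => h (α r)⟩) fun n => (c n).rand hα)

instance instHomOrder : OmegaCompletePartialOrder (Hom X Y) where
  ωSup := homSup
  le_ωSup c i x := le_ωSup (evalChain c x) i
  ωSup_le _ _ h x := ωSup_le _ _ fun n => h n x

/-! ### Identities, composition, products -/

protected def id (X : OmegaQbs.{u}) : Hom X X := mkHom (fun x => x) ωScottContinuous.id fun _ h => h

def comp (g : Hom Y Z) (f : Hom X Y) : Hom X Z :=
  mkHom (fun x => g (f x)) (g.cont.comp f.cont) fun _ h => g.rand (f.rand h)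

@[simp]
theorem comp_apply (g : Hom Y Z) (f : Hom X Y) (x : X) : comp g f x = g (f x) := rfl

def const (X : OmegaQbs.{u}) (y : Y) : Hom X Y :=
  mkHom (fun _ => y) ωScottContinuous.const fun _ _ => Y.const_mem y

/-- Binary products. -/
def prod (X : OmegaQbs.{u}) (Y : OmegaQbs.{v}) : OmegaQbs.{max u v} where
  carrier := X × Y
  order := inferInstance
  rand := {γ | (fun r => (γ r).1) ∈ X.rand ∧ (fun r => (γ r).2) ∈ Y.rand}
  const_mem x := ⟨X.const_mem x.1, Y.const_mem x.2⟩
  comp_mem γ h g hg := ⟨X.comp_mem _ h.1 g hg, Y.comp_mem _ h.2 g hg⟩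
  glue_mem p γ hp h := ⟨X.glue_mem p (fun n r => (γ n r).1) hp fun n => (h n).1,
    Y.glue_mem p (fun n r => (γ n r).2) hp fun n => (h n).2⟩
  lub_mem c h := ⟨X.lub_mem (c.map ⟨fun γ r => (γ r).1, fun _ _ h r => (h r).1⟩) fun n => (h n).1,
    Y.lub_mem (c.map ⟨fun γ r => (γ r).2, fun _ _ h r => (h r).2⟩) fun n => (h n).2⟩

def fst (X : OmegaQbs.{u}) (Y : OmegaQbs.{v}) : Hom (prod X Y) X :=
  mkHom (fun z => Prod.fst z) Prod.ωScottContinuous_fst fun _ h => h.1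

def snd (X : OmegaQbs.{u}) (Y : OmegaQbs.{v}) : Hom (prod X Y) Y :=
  mkHom (fun z => Prod.snd z) Prod.ωScottContinuous_snd fun _ h => h.2

def pair (f : Hom X Y) (g : Hom X Z) : Hom X (prod Y Z) :=
  mkHom (fun x => ((f x, g x) : Y × Z)) (Prod.ωScottContinuous.prodMk f.cont g.cont) fun _ h => ⟨f.rand h, g.rand h⟩

/-! ### Reals, weights -/

/-- The space of real values, with the discrete order. -/
def realQ : OmegaQbs.{0} where
  carrier := ℝ
  order := discreteOmegaCPO ℝ
  rand := {f | Measurable f}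
  const_mem _ := measurable_const
  comp_mem _ h _ hg := h.comp hg
  glue_mem p α hp h := by
    have : Measurable (fun q : ℕ × ℝ => α q.1 q.2) := measurable_from_prod_countable_right h
    exact this.comp (hp.prodMk measurable_id)
  lub_mem c h := by
    let _ := discreteOmegaCPO ℝ
    exact h 0

theorem measurable_iSup_chain (c : Chain (ℝ → ℝ≥0∞)) (h : ∀ n, Measurable (c n)) :
    Measurable (ωSup c) :=
  Measurable.iSup (f := fun n => c n) h

/-- The space of weights `[0, ∞]` with its linear order. -/
noncomputable def weight : OmegaQbs.{0} where
  carrier := ℝ≥0∞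
  order := inferInstance
  rand := {f | Measurable f}
  const_mem _ := measurable_const
  comp_mem _ h _ hg := h.comp hg
  glue_mem p α hp h := by
    have : Measurable (fun q : ℕ × ℝ => α q.1 q.2) := measurable_from_prod_countable_right h
    exact this.comp (hp.prodMk measurable_id)
  lub_mem c h := measurable_iSup_chain c h

/-! ### Exponentials -/

/-- Random elements of the exponential `Y ^ X`: the curried morphisms `ℝ × X → Y`. -/
def expRand (X : OmegaQbs.{u}) (Y : OmegaQbs.{v}) : Set (ℝ → Hom X Y) :=
  {β | ∃ a : Hom (prod realQ X) Y, ∀ (r : ℝ) (x : X), β r x = a (r, x)}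

theorem mem_expRand {β : ℝ → Hom X Y} : β ∈ expRand X Y ↔
    ∀ g : ℝ → ℝ, Measurable g → ∀ α ∈ X.rand, (fun r => β (g r) (α r)) ∈ Y.rand := by
  constructor
  · rintro ⟨a, ha⟩ g hg α hα
    simp only [ha]
    exact a.rand (α := fun r => ((g r, α r) : realQ × X)) ⟨hg, hα⟩
  · intro h
    refine ⟨mkHom (fun z : realQ × X => β z.1 z.2) (continuous_of_le ?_ ?_) ?_, fun r x => rfl⟩
    · rintro ⟨r, x⟩ ⟨s, y⟩ ⟨h1, h2⟩
      have h1 : r = s := h1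
      subst h1
      exact (β r).mono h2
    · intro c b hb
      refine le_of_continuous (β (c 0).1).cont (c.map OrderHom.snd) b fun n => ?_
      have : (c 0).1 = (c n).1 := (c.monotone (Nat.zero_le n)).1
      change β (c 0).1 (c n).2 ≤ b
      rw [this]
      exact hb n
    · rintro γ ⟨h1, h2⟩
      exact h _ h1 _ h2

/-- Exponentials `Y ^ X`. -/
def exp (X : OmegaQbs.{u}) (Y : OmegaQbs.{v}) : OmegaQbs.{max u v} where
  carrier := Hom X Y
  order := inferInstance
  rand := expRand X Y
  const_mem f := mem_expRand.2 fun _ _ _ hα => f.rand hα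
  comp_mem β h g hg := mem_expRand.2 fun g' hg' α hα =>
    mem_expRand.1 h _ (hg.comp hg') α hα
  glue_mem p β hp h := mem_expRand.2 fun g hg α hα =>
    Y.glue_mem (fun r => p (g r)) (fun n r => β n (g r) (α r)) (hp.comp hg)
      fun n => mem_expRand.1 (h n) g hg α hα
  lub_mem c h := mem_expRand.2 fun g hg α hα =>
    Y.lub_mem (c.map ⟨fun β r => β (g r) (α r), fun _ _ h r => h (g r) (α r)⟩)
      fun n => mem_expRand.1 (h n) g hg α hα

instance (X : OmegaQbs.{u}) (Y : OmegaQbs.{v}) : FunLike (exp X Y) X Y :=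
  inferInstanceAs (FunLike (Hom X Y) X Y)

theorem mem_exp_rand {β : ℝ → exp X Y} : β ∈ (exp X Y).rand ↔
    ∀ g : ℝ → ℝ, Measurable g → ∀ α ∈ X.rand, (fun r => β (g r) (α r)) ∈ Y.rand :=
  mem_expRand

theorem exp_rand_apply {β : ℝ → exp X Y} (h : β ∈ (exp X Y).rand) {α : ℝ → X} (hα : α ∈ X.rand) :
    (fun r => β r (α r)) ∈ Y.rand :=
  mem_exp_rand.1 h _ measurable_id α hα

theorem continuous_apply {A : Type w} [OmegaCompletePartialOrder A] {f : A → exp X Y} {g : A → X}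
    (hf : ωScottContinuous f) (hg : ωScottContinuous g) : ωScottContinuous fun a => f a (g a) := by
  refine continuous_of_le (fun a b h => le_trans ((f a).mono (hg.monotone h))
    (hf.monotone h (g b))) fun c b h => ?_
  rw [hg.map_ωSup]
  refine le_of_continuous (f (ωSup c)).cont _ b fun n => ?_
  rw [hf.map_ωSup]
  refine ωSup_le _ _ fun m => ?_
  refine le_trans ?_ (h (max m n))
  exact le_trans (hf.monotone (c.monotone (le_max_left m n)) (g (c n)))
    ((f _).mono (hg.monotone (c.monotone (le_max_right m n))))

theorem continuous_exp {A : Type w} [OmegaCompletePartialOrder A] {f : A → exp X Y}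
    (hf : ∀ x, ωScottContinuous fun a => f a x) : ωScottContinuous f :=
  continuous_of_le (fun _ _ h x => (hf x).monotone h) fun c b h x =>
    le_of_continuous (hf x) c (b x) fun n => h n x

/-- Evaluation. -/
def eval (X : OmegaQbs.{u}) (Y : OmegaQbs.{v}) : Hom (prod (exp X Y) X) Y :=
  mkHom (fun z => z.1 z.2)
    (continuous_apply Prod.ωScottContinuous_fst Prod.ωScottContinuous_snd)
    fun _ h => exp_rand_apply h.1 h.2

/-- Currying. -/
def curry (f : Hom (prod X Y) Z) : Hom X (exp Y Z) :=
  mkHom (fun x => comp f (pair (const Y x) (OmegaQbs.id Y)))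
    (continuous_exp fun y => (comp f (pair (OmegaQbs.id X) (const X y))).cont)
    fun α hα => mem_exp_rand.2 fun g hg β hβ =>
      f.rand (α := fun r => (α (g r), β r)) ⟨X.comp_mem α hα g hg, hβ⟩

@[simp]
theorem curry_apply (f : Hom (prod X Y) Z) (x : X) (y : Y) : curry f x y = f (x, y) := rfl

/-! ### Lifting -/

theorem exists_tail {α : Type u} [OmegaCompletePartialOrder α] (c : Chain (WithBot α)) {N : ℕ}
    (h : c N ≠ ⊥) : ∃ d : Chain α, ∀ k, c (N + k) = (d k : WithBot α) := by
  have hb : ∀ k, c (N + k) ≠ ⊥ := fun k hk =>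
    h (le_bot_iff.1 (hk ▸ c.monotone (Nat.le_add_right N k)))
  refine ⟨⟨⟨fun k => (c (N + k)).unbot (hb k), fun i j hij => ?_⟩⟩, fun k => ?_⟩
  · rw [← WithBot.coe_le_coe, WithBot.coe_unbot, WithBot.coe_unbot]
    exact c.monotone (Nat.add_le_add_left hij N)
  · exact (WithBot.coe_unbot _ _).symm

open scoped Classical in
/-- Lubs of chains in the lifting of an `ω`-cpo: the lub of the defined tail, if there is one. -/
noncomputable def liftSup {α : Type u} [OmegaCompletePartialOrder α] (c : Chain (WithBot α)) :
    WithBot α :=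
  if h : ∃ N, c N ≠ ⊥ then ((ωSup (exists_tail c h.choose_spec).choose : α) : WithBot α) else ⊥

noncomputable instance instLiftOrder (α : Type u) [OmegaCompletePartialOrder α] :
    OmegaCompletePartialOrder (WithBot α) where
  ωSup := liftSup
  le_ωSup c i := by
    by_cases h : ∃ N, c N ≠ ⊥
    · rw [liftSup, dif_pos h]
      have hd := (exists_tail c h.choose_spec).choose_spec
      refine le_trans (c.monotone (Nat.le_add_left i h.choose)) (le_of_eq_of_le (hd i) ?_)
      exact WithBot.coe_le_coe.2 (le_ωSup _ i)
    · have : c i = ⊥ := by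
        by_contra hi
        exact h ⟨i, hi⟩
      rw [this]
      exact bot_le
  ωSup_le c x hx := by
    by_cases h : ∃ N, c N ≠ ⊥
    · rw [liftSup, dif_pos h]
      have hd := (exists_tail c h.choose_spec).choose_spec
      have hx' : ∀ k, ((exists_tail c h.choose_spec).choose k : WithBot α) ≤ x := fun k => by
        rw [← hd k]
        exact hx _
      induction x with
      | bot => exact absurd (hx' 0) (by simp)
      | coe x => exact WithBot.coe_le_coe.2 (ωSup_le _ _ fun k => WithBot.coe_le_coe.1 (hx' k))
    · rw [liftSup, dif_neg h]
      exact bot_le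

theorem liftSup_eq_coe {α : Type u} [OmegaCompletePartialOrder α] (c : Chain (WithBot α)) {N : ℕ}
    {d : Chain α} (h : ∀ k, c (N + k) = (d k : WithBot α)) : ωSup c = ((ωSup d : α) : WithBot α) := by
  refine le_antisymm (ωSup_le _ _ fun i => ?_) ?_
  · refine le_trans (c.monotone (Nat.le_add_left i N)) (le_of_eq_of_le (h i) ?_)
    exact WithBot.coe_le_coe.2 (le_ωSup _ i)
  · have hN : ωSup c ≠ ⊥ := fun hb => by
      have := le_ωSup c N
      rw [hb, show c N = _ from h 0] at this
      simp at this
    obtain ⟨y, hy⟩ := WithBot.ne_bot_iff_exists.1 hN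
    rw [← hy]
    refine WithBot.coe_le_coe.2 (ωSup_le _ _ fun k => WithBot.coe_le_coe.1 ?_)
    rw [← h k, hy]
    exact le_ωSup c _

theorem liftSup_eq_bot {α : Type u} [OmegaCompletePartialOrder α] (c : Chain (WithBot α))  :
    ωSup c = ⊥ ↔ ∀ n, c n = ⊥ :=
  ⟨fun h n => le_bot_iff.1 (h ▸ le_ωSup c n), fun h => le_bot_iff.1 (ωSup_le _ _ fun n => (h n).le)⟩

/-- Extension of `f` to the lifting, with value `b` at `⊥`. -/
def liftElim {α : Type u} {β : Type v} (b : β) (f : α → β) : WithBot α → β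
  | none => b
  | some a => f a

@[simp]
theorem liftElim_bot {α : Type u} {β : Type v} (b : β) (f : α → β) : liftElim b f ⊥ = b := rfl

@[simp]
theorem liftElim_coe {α : Type u} {β : Type v} (b : β) (f : α → β) (a : α) :
    liftElim b f (a : WithBot α) = f a := rfl

theorem continuous_liftElim {A : Type u} {α : Type v} {β : Type w} [OmegaCompletePartialOrder A]
    [OmegaCompletePartialOrder α] [OmegaCompletePartialOrder β] {b : β} (hb : ∀ y, b ≤ y)
    {F : A → α → β} {g : A → WithBot α} (hF : ωScottContinuous fun z : A × α => F z.1 z.2)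
    (hg : ωScottContinuous g) : ωScottContinuous fun a => liftElim b (F a) (g a) := by
  refine continuous_of_le (fun x y h => ?_) fun c y h => ?_
  · have h1 := hg.monotone h
    revert h1
    cases g x with
    | bot => exact fun _ => hb _
    | coe p =>
      cases g y with
      | bot => exact fun h1 => absurd h1 (by simp)
      | coe q =>
        exact fun h1 => hF.monotone (a := (x, p)) (b := (y, q)) ⟨h, WithBot.coe_le_coe.1 h1⟩
  · rw [hg.map_ωSup]
    by_cases hN : ∃ N, g (c N) ≠ ⊥
    · obtain ⟨N, hN⟩ := hN
      obtain ⟨d, hd⟩ := exists_tail (c.map ⟨g, hg.monotone⟩) (N := N) hN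
      rw [liftSup_eq_coe _ hd, liftElim_coe]
      let c' : Chain A := ⟨⟨fun k => c (N + k), fun i j hij =>
        c.monotone (Nat.add_le_add_left hij N)⟩⟩
      have hc : ωSup c = ωSup c' := le_antisymm
        (ωSup_le _ _ fun n => le_ωSup_of_le (c := c') n (c.monotone (Nat.le_add_left n N)))
        (ωSup_le _ _ fun n => le_ωSup c (N + n))
      rw [hc]
      refine le_of_continuous hF (c'.zip d) y fun k => ?_
      have hk : g (c (N + k)) = d k := hd k
      have := h (N + k)
      rw [hk] at this
      exact this
    · rw [(liftSup_eq_bot _).2 fun n => by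
        by_contra hn
        exact hN ⟨n, hn⟩]
      exact hb y

/-- Random elements of the lifting: partial functions with Borel domain that agree on their domain
with a random element of `X` (if the domain is empty, no random element of `X` is needed). -/
def liftRand (X : OmegaQbs.{u}) : Set (ℝ → WithBot X) :=
  {f | MeasurableSet {r | f r ≠ ⊥} ∧
    ((∃ r, f r ≠ ⊥) → ∃ α ∈ X.rand, ∀ r, f r ≠ ⊥ → f r = (α r : WithBot X))}

theorem ite_mem (X : OmegaQbs.{u}) {B : Set ℝ} [DecidablePred (· ∈ B)] (hB : MeasurableSet B)
    {α β : ℝ → X} (hα : α ∈ X.rand) (hβ : β ∈ X.rand) :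
    (fun r => if r ∈ B then α r else β r) ∈ X.rand := by
  have := X.glue_mem (fun r => if r ∈ B then 0 else 1) (fun n => if n = 0 then α else β)
    (Measurable.ite hB measurable_const measurable_const)
    (fun n => by split_ifs <;> assumption)
  convert this using 2 with r
  by_cases hr : r ∈ B <;> simp [hr]

theorem mem_liftRand {f : ℝ → WithBot X} : f ∈ liftRand X ↔
    MeasurableSet {r | f r ≠ ⊥} ∧ ∀ x : X, (fun r => liftElim x (fun y => y) (f r)) ∈ X.rand := by
  classical
  refine ⟨fun ⟨h1, h2⟩ => ⟨h1, fun x => ?_⟩, fun ⟨h1, h2⟩ => ⟨h1, ?_⟩⟩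
  · by_cases h : ∃ r, f r ≠ ⊥
    · obtain ⟨α, hα, hf⟩ := h2 h
      convert ite_mem X h1 hα (X.const_mem x) using 2 with r
      by_cases hr : f r = ⊥
      · simp [hr]
      · simp only [Set.mem_ofPred_eq, ne_eq, hr, not_false_eq_true, if_true]
        rw [hf r hr, liftElim_coe]
    · push Not at h
      simp only [h, liftElim_bot]
      exact X.const_mem x
  · rintro ⟨r, hr⟩
    obtain ⟨x, -⟩ := WithBot.ne_bot_iff_exists.1 hr
    refine ⟨_, h2 x, fun s hs => ?_⟩
    obtain ⟨y, hy⟩ := WithBot.ne_bot_iff_exists.1 hs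
    rw [← hy, liftElim_coe]

theorem lift_lub_mem (c : Chain (ℝ → WithBot X)) (h : ∀ n, c n ∈ liftRand X) :
    ωSup c ∈ liftRand X := by
  classical
  have hdom : {r | ωSup c r ≠ ⊥} = ⋃ n, {r | c n r ≠ ⊥} := by
    ext r
    simp only [Set.mem_ofPred_eq, Set.mem_iUnion, ne_eq]
    rw [show ωSup c r = ωSup (c.map (Pi.evalOrderHom r)) from rfl, liftSup_eq_bot]
    exact not_forall
  have hm : MeasurableSet {r | ωSup c r ≠ ⊥} := by
    rw [hdom]
    exact MeasurableSet.iUnion fun n => (h n).1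
  refine mem_liftRand.2 ⟨hm, fun x => ?_⟩
  have hex : ∀ r, ∃ n, c n r ≠ ⊥ ∨ ωSup c r = ⊥ := fun r => by
    by_cases hr : ωSup c r = ⊥
    · exact ⟨0, Or.inr hr⟩
    · have : r ∈ ⋃ n, {r | c n r ≠ ⊥} := hdom ▸ hr
      obtain ⟨n, hn⟩ := Set.mem_iUnion.1 this
      exact ⟨n, Or.inl hn⟩
  have hp : Measurable fun r => Nat.find (hex r) := measurable_find hex fun n => by
    have := (h n).1.union hm.compl
    convert this using 1
    ext r
    simp
  have hspec : ∀ r, (c (Nat.find (hex r)) r ≠ ⊥) ∨ ωSup c r = ⊥ := fun r => Nat.find_spec (hex r)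
  have hmono : Monotone fun (k : ℕ) (r : ℝ) =>
      liftElim x (fun y => y) (c (Nat.find (hex r) + k) r) := by
    intro i j hij r
    dsimp only
    rcases hspec r with hr | hr
    · obtain ⟨d, hd⟩ := exists_tail (c.map (Pi.evalOrderHom r)) hr
      have hd : ∀ k, c (Nat.find (hex r) + k) r = (d k : WithBot X) := hd
      rw [hd, hd]
      exact d.monotone hij
    · have hb := (liftSup_eq_bot (c.map (Pi.evalOrderHom r))).1 hr
      have hb : ∀ n, c n r = ⊥ := hb
      rw [hb, hb]
  have := X.lub_mem ⟨⟨_, hmono⟩⟩ fun k =>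
    X.glue_mem _ (fun n r => liftElim x (fun y => y) (c (n + k) r)) hp fun n =>
      (mem_liftRand.1 (h (n + k))).2 x
  convert this using 1
  funext r
  rcases hspec r with hr | hr
  · obtain ⟨d, hd⟩ := exists_tail (c.map (Pi.evalOrderHom r)) hr
    rw [show ωSup c r = ωSup (c.map (Pi.evalOrderHom r)) from rfl, liftSup_eq_coe _ hd,
      liftElim_coe]
    have hd : ∀ k, c (Nat.find (hex r) + k) r = (d k : WithBot X) := hd
    refine congrArg ωSup (Chain.ext (funext fun k => ?_))
    change d k = liftElim x (fun y => y) (c (Nat.find (hex r) + k) r)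
    rw [hd, liftElim_coe]
  · have hb := (liftSup_eq_bot (c.map (Pi.evalOrderHom r))).1 hr
    have hb : ∀ n, c n r = ⊥ := hb
    rw [hr, liftElim_bot]
    refine le_antisymm (le_ωSup_of_le 0 ?_) (ωSup_le _ _ fun k => ?_)
    · change x ≤ liftElim x (fun y => y) (c (Nat.find (hex r) + 0) r)
      rw [hb, liftElim_bot]
    · change liftElim x (fun y => y) (c (Nat.find (hex r) + k) r) ≤ x
      rw [hb, liftElim_bot]

/-- The lifting `X_⊥`. -/
noncomputable def lift (X : OmegaQbs.{u}) : OmegaQbs.{u} where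
  carrier := WithBot X
  order := inferInstance
  rand := liftRand X
  const_mem x := mem_liftRand.2 ⟨by simp, fun _ => X.const_mem _⟩
  comp_mem f h g hg := by
    rw [mem_liftRand] at h ⊢
    exact ⟨hg h.1, fun x => X.comp_mem _ (h.2 x) g hg⟩
  glue_mem p f hp h := by
    refine mem_liftRand.2 ⟨?_, fun x => X.glue_mem p
      (fun n r => liftElim x (fun y => y) (f n r)) hp fun n => (mem_liftRand.1 (h n)).2 x⟩
    have : {r | f (p r) r ≠ ⊥} = ⋃ n, p ⁻¹' {n} ∩ {r | f n r ≠ ⊥} := by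
      ext r
      simp
    rw [this]
    exact MeasurableSet.iUnion fun n => (hp (measurableSet_singleton n)).inter (h n).1
  lub_mem := lift_lub_mem

/-- The undefined value. -/
noncomputable def undef (X : OmegaQbs.{u}) : lift X := (⊥ : WithBot X)

theorem undef_le (x : lift X) : undef X ≤ x := bot_le (α := WithBot X)

/-- The total value `↓x`. -/
def defined (x : X) : lift X := (x : WithBot X)

/-- If `f` is partial and random, and `F r` maps random elements to random elements, then so is the
extension of `F` to the lifting. -/
theorem liftElim_mem {b : Y} {F : ℝ → X → Y} (hF : ∀ α ∈ X.rand, (fun r => F r (α r)) ∈ Y.rand)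
    {f : ℝ → lift X} (hf : f ∈ (lift X).rand) : (fun r => liftElim b (F r) (f r)) ∈ Y.rand := by
  classical
  by_cases h : ∃ r, f r ≠ undef X
  · obtain ⟨α, hα, hf'⟩ := hf.2 h
    convert ite_mem Y hf.1 (hF α hα) (Y.const_mem b) using 2 with r
    by_cases hr : f r = (⊥ : WithBot X)
    · exact (congrArg (liftElim b (F r)) hr).trans (if_neg (not_not_intro hr)).symm
    · exact (congrArg (liftElim b (F r)) (hf' r hr)).trans (if_pos hr).symm
  · push Not at h
    simp only [h]
    exact Y.const_mem b

/-! ### Strong monad structures -/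

/-- A strong monad structure on an assignment `T` of objects: a unit and an internal bind. -/
structure StrongMonadStr (T : OmegaQbs.{u} → OmegaQbs.{u}) where
  ret : ∀ X : OmegaQbs.{u}, Hom X (T X)
  bind : ∀ X Y : OmegaQbs.{u}, Hom (prod (T X) (exp X (T Y))) (T Y)

/-- The monad laws. -/
structure StrongMonadStr.IsStrongMonad {T : OmegaQbs.{u} → OmegaQbs.{u}} (M : StrongMonadStr T) :
    Prop where
  ret_bind : ∀ (X Y : OmegaQbs.{u}) (x : X) (f : Hom X (T Y)), M.bind X Y (M.ret X x, f) = f x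
  bind_ret : ∀ (X : OmegaQbs.{u}) (a : T X), M.bind X X (a, M.ret X) = a
  bind_assoc : ∀ (X Y Z : OmegaQbs.{u}) (a : T X) (f : Hom X (T Y)) (g : Hom Y (T Z)),
    M.bind Y Z (M.bind X Y (a, f), g) =
      M.bind X Z (a, comp (M.bind Y Z) (pair f (const X (Y := exp Y (T Z)) g)))

/-- The family `h` preserves the monad structures: it commutes with units and binds. -/
structure PreservesMonadStr {S T : OmegaQbs.{u} → OmegaQbs.{u}} (M : StrongMonadStr S)
    (N : StrongMonadStr T) (h : ∀ X, Hom (S X) (T X)) : Prop where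
  map_ret : ∀ (X : OmegaQbs.{u}) (x : X), h X (M.ret X x) = N.ret X x
  map_bind : ∀ (X Y : OmegaQbs.{u}) (a : S X) (f : Hom X (S Y)),
    h Y (M.bind X Y (a, f)) = N.bind X Y (h X a, comp (h Y) f)

/-! ### The continuation monad `J` -/

/-- `J X = W ^ (W ^ X)`, where `W` is the space of weights. -/
noncomputable def J (X : OmegaQbs.{u}) : OmegaQbs.{u} := exp (exp X weight) weight

noncomputable instance (X : OmegaQbs.{u}) : FunLike (J X) (exp X weight) weight :=
  inferInstanceAs (FunLike (Hom (exp X weight) weight) (exp X weight) weight)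

/-- The unit `x ↦ (w ↦ w x)`. -/
noncomputable def jRet (X : OmegaQbs.{u}) : Hom X (J X) :=
  curry (comp (eval X weight) (pair (snd X (exp X weight)) (fst X (exp X weight))))

/-- The bind `(μ, f) ↦ (w ↦ μ (x ↦ f x w))`. -/
noncomputable def jBind (X Y : OmegaQbs.{u}) : Hom (prod (J X) (exp X (J Y))) (J Y) :=
  let A := prod (prod (J X) (exp X (J Y))) (exp Y weight)
  let inner : Hom (prod A X) weight :=
    comp (eval (exp Y weight) weight)
      (pair (comp (eval X (J Y)) (pair
          (comp (comp (snd _ _) (fst _ _)) (fst A X)) (snd A X)))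
        (comp (snd _ _) (fst A X)))
  curry (comp (eval (exp X weight) weight) (pair (comp (fst _ _) (fst _ _)) (curry inner)))

theorem jRet_apply (X : OmegaQbs.{u}) (x : X) (w : exp X weight) : jRet X x w = w x := rfl

theorem jBind_apply (X Y : OmegaQbs.{u}) (μ : J X) (f : exp X (J Y)) (w : exp Y weight) :
    jBind X Y (μ, f) w = μ (comp (eval (exp Y weight) weight) (pair f (const X w))) := rfl

noncomputable def jMonad : StrongMonadStr J.{u} where
  ret := jRet
  bind := jBind

/-! ### Randomisations -/

/-- The space of randomisations `R X = (X_⊥) ^ ℝ`. -/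
noncomputable def R (X : OmegaQbs.{u}) : OmegaQbs.{u} := exp realQ (lift X)

noncomputable instance (X : OmegaQbs.{u}) : FunLike (R X) ℝ (WithBot X) :=
  inferInstanceAs (FunLike (Hom realQ (lift X)) realQ (lift X))

theorem continuous_prod_real {f : prod X realQ → Y}
    (h : ∀ r : ℝ, ωScottContinuous fun x : X => f (x, r)) : ωScottContinuous f := by
  refine continuous_of_le ?_ fun c b hb => ?_
  · rintro ⟨x, r⟩ ⟨y, s⟩ ⟨h1, h2⟩
    have h2 : r = s := h2
    subst h2
    exact (h r).monotone h1
  · refine le_of_continuous (h (c 0).2) (c.map OrderHom.fst) b fun n => ?_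
    have : (c 0).2 = (c n).2 := (c.monotone (Nat.zero_le n)).2
    change f ((c n).1, (c 0).2) ≤ b
    rw [this]
    exact hb n

theorem continuous_coe (X : OmegaQbs.{u}) : ωScottContinuous (defined : X → lift X) :=
  continuous_of_le (fun _ _ h => WithBot.coe_le_coe.2 h) fun c b h => by
    have := liftSup_eq_coe (α := X) (c.map ⟨defined, fun _ _ h => WithBot.coe_le_coe.2 h⟩)
      (N := 0) (d := c) (fun k => by rw [Nat.zero_add]; rfl)
    exact le_of_eq_of_le this.symm (ωSup_le _ _ h)

open scoped Classical in
/-- The partial function defined on `[0, 1]`, with constant value `x` there. -/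
noncomputable def rRetFun (x : X) (r : ℝ) : lift X :=
  if r ∈ Set.Icc (0 : ℝ) 1 then defined x else undef X

/-- The unit of `R`. -/
noncomputable def rRet (X : OmegaQbs.{u}) : Hom X (R X) :=
  curry (mkHom (X := prod X realQ) (Y := lift X) (fun z => rRetFun z.1 z.2)
    (continuous_prod_real fun r => by
      by_cases hr : r ∈ Set.Icc (0 : ℝ) 1
      · have : (fun x : X => rRetFun x r) = defined := funext fun x => if_pos hr
        exact this ▸ continuous_coe X
      · have : (fun x : X => rRetFun x r) = Function.const X (undef X) := funext fun x => if_neg hr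
        exact this ▸ ωScottContinuous.const)
    (fun γ hγ => by
      classical
      have hm : MeasurableSet {r : ℝ | (fun r => (γ r).2 : ℝ → ℝ) r ∈ Set.Icc (0 : ℝ) 1} :=
        hγ.2 measurableSet_Icc
      have := ite_mem (lift X) hm (α := fun r => defined (γ r).1)
        (mem_liftRand.2 ⟨by simp [defined], fun x => hγ.1⟩) ((lift X).const_mem (undef X))
      convert this using 1
      funext r
      simp only [rRetFun]
      congr 1))

theorem rRet_apply_of_mem (X : OmegaQbs.{u}) (x : X) {r : ℝ} (hr : r ∈ Set.Icc (0 : ℝ) 1) :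
    rRet X x r = (x : WithBot X) := if_pos hr

theorem rRet_apply_of_notMem (X : OmegaQbs.{u}) (x : X) {r : ℝ} (hr : r ∉ Set.Icc (0 : ℝ) 1) :
    rRet X x r = ⊥ := if_neg hr

/-- A measurable partial function `φ : ℝ ⇀ ℝ × ℝ` that pushes the Lebesgue measure on `ℝ` forward to
the Lebesgue measure on `ℝ × ℝ`. -/
def IsTransfer (φ : Hom realQ (lift (prod realQ realQ))) : Prop :=
  ∀ A : Set (ℝ × ℝ), MeasurableSet A →
    volume {r : ℝ | ∃ p ∈ A, φ r = defined p} = (volume : Measure (ℝ × ℝ)) A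

/-- Sequencing of randomisations: split the source of randomness `r` as `φ r = (s, t)`, then run
`f (α t)` on `s`; the result is undefined as soon as one of the steps is. -/
noncomputable def rBindFun (φ : Hom realQ (lift (prod realQ realQ))) {X Y : OmegaQbs.{u}} (α : R X)
    (f : exp X (R Y)) (r : ℝ) : lift Y :=
  liftElim (undef Y) (fun st : ℝ × ℝ => liftElim (undef Y) (fun x => f x st.1) (α st.2)) (φ r)

/-- The bind of `R`. -/
noncomputable def rBind (φ : Hom realQ (lift (prod realQ realQ))) (X Y : OmegaQbs.{u}) :
    Hom (prod (R X) (exp X (R Y))) (R Y) :=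
  curry (mkHom (X := prod (prod (R X) (exp X (R Y))) realQ) (Y := lift Y)
    (fun z => rBindFun φ z.1.1 z.1.2 z.2)
    (by
      refine continuous_liftElim (A := (R X × exp X (R Y)) × realQ) (α := realQ × realQ) undef_le
        (F := fun z st => liftElim (undef Y) (fun x => z.1.2 x st.1) (z.1.1 st.2)) ?_
        (φ.cont.comp Prod.ωScottContinuous_snd)
      refine continuous_liftElim (A := ((R X × exp X (R Y)) × realQ) × (realQ × realQ)) (α := X)
        undef_le (F := fun z x => z.1.1.2 x z.2.1) ?_ ?_
      · exact continuous_apply (X := realQ) (Y := lift Y)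
          (f := fun z : (((R X × exp X (R Y)) × realQ) × (realQ × realQ)) × X => z.1.1.1.2 z.2)
          (continuous_apply (X := X) (Y := R Y) (by fun_prop) (by fun_prop)) (by fun_prop)
      · exact continuous_apply (X := realQ) (Y := lift X)
          (f := fun z : ((R X × exp X (R Y)) × realQ) × (realQ × realQ) => z.1.1.1)
          (by fun_prop) (by fun_prop))
    (fun γ hγ => by
      refine liftElim_mem (X := prod realQ realQ) (Y := lift Y) (fun p hp => ?_) (φ.rand hγ.2)
      refine liftElim_mem (X := X) (Y := lift Y) (fun α hα => ?_)
        (exp_rand_apply hγ.1.1 hp.2)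
      exact exp_rand_apply (exp_rand_apply hγ.1.2 hα) hp.1))

theorem rBind_apply (φ : Hom realQ (lift (prod realQ realQ))) (X Y : OmegaQbs.{u}) (α : R X)
    (f : exp X (R Y)) (r : ℝ) : rBind φ X Y (α, f) r =
      liftElim ⊥ (fun st : ℝ × ℝ => liftElim ⊥ (fun x => f x st.1) (α st.2)) (φ r) := rfl

noncomputable def rMonad (φ : Hom realQ (lift (prod realQ realQ))) : StrongMonadStr R.{u} where
  ret := rRet
  bind := rBind φ

/-! ### Expectation operators -/

/-- The integral of `w ∘ α` over the domain of `α`. -/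
noncomputable def expectation (α : R X) (w : exp X weight) : ℝ≥0∞ :=
  ∫⁻ r, liftElim (0 : ℝ≥0∞) w (α r)

theorem measurable_integrand {A : ℝ → R X} (hA : A ∈ (R X).rand) {w : ℝ → exp X weight}
    (hw : w ∈ (exp X weight).rand) :
    Measurable fun z : ℝ × ℝ => liftElim (0 : ℝ≥0∞) (w z.1) (A z.1 z.2) := by
  let e : ℝ ≃ᵐ ℝ × ℝ := PolishSpace.measurableEquivOfNotCountable (not_countable) (not_countable)
  have h1 : Measurable fun r => (e r).1 := measurable_fst.comp e.measurable
  have h2 : Measurable fun r => (e r).2 := measurable_snd.comp e.measurable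
  have : (fun r => liftElim (0 : ℝ≥0∞) (w (e r).1) (A (e r).1 (e r).2)) ∈ weight.rand :=
    liftElim_mem (X := X) (Y := weight) (fun α hα => mem_exp_rand.1 hw _ h1 α hα)
      (mem_exp_rand.1 hA _ h1 _ h2)
  have : Measurable fun r => liftElim (0 : ℝ≥0∞) (w (e r).1) (A (e r).1 (e r).2) := this
  have := this.comp e.symm.measurable
  simpa [Function.comp_def] using this

theorem measurable_integrand' (α : R X) (w : exp X weight) :
    Measurable fun r : ℝ => liftElim (0 : ℝ≥0∞) w (α r) :=
  (measurable_integrand ((R X).const_mem α) ((exp X weight).const_mem w)).comp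
    (measurable_const (a := (0 : ℝ)).prodMk measurable_id)

theorem weight_zero_le (y : ℝ≥0∞) : 0 ≤ y := zero_le

theorem continuous_integrand (r : ℝ) : ωScottContinuous fun z : R X × exp X weight =>
    (liftElim (0 : ℝ≥0∞) z.2 (z.1 r) : weight) := by
  refine continuous_liftElim (A := R X × exp X weight) (α := X) (β := weight)
    weight_zero_le (F := fun z x => z.2 x) ?_ ?_
  · exact continuous_apply (X := X) (Y := weight)
      (f := fun z : (R X × exp X weight) × X => z.1.2) (by fun_prop) (by fun_prop)
  · exact continuous_apply (X := realQ) (Y := lift X)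
      (f := fun z : R X × exp X weight => z.1) (by fun_prop) ωScottContinuous.const

theorem continuous_expectation : ωScottContinuous fun z : R X × exp X weight =>
    (expectation z.1 z.2 : weight) := by
  refine continuous_of_le
    (fun y z h => lintegral_mono fun r => (continuous_integrand (X := X) r).monotone h)
    fun c b h => ?_
  have h1 : (fun r : ℝ => liftElim (0 : ℝ≥0∞) (ωSup c).2 ((ωSup c).1 r)) =
      fun r => ⨆ n, liftElim (0 : ℝ≥0∞) (c n).2 ((c n).1 r) :=
    funext fun r => (continuous_integrand (X := X) r).map_ωSup c
  change ∫⁻ r : ℝ, (fun r : ℝ => liftElim (0 : ℝ≥0∞) (ωSup c).2 ((ωSup c).1 r)) r ≤ (b : ℝ≥0∞)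
  rw [h1]
  have h2 := lintegral_iSup (μ := (volume : Measure ℝ))
    (f := fun n r => liftElim (0 : ℝ≥0∞) (c n).2 ((c n).1 r))
    (fun n => measurable_integrand' _ _)
    (fun i j hij r => (continuous_integrand (X := X) r).monotone (c.monotone hij))
  exact le_of_eq_of_le h2 (iSup_le h)

/-- The expectation morphism `R X → J X`. -/
noncomputable def E (X : OmegaQbs.{u}) : Hom (R X) (J X) :=
  curry (mkHom (X := prod (R X) (exp X weight)) (Y := weight) (fun z => expectation z.1 z.2)
    continuous_expectation
    fun γ hγ => (measurable_integrand hγ.1 hγ.2).lintegral_prod_right')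

theorem E_apply (X : OmegaQbs.{u}) (α : R X) (w : exp X weight) :
    E X α w = ∫⁻ r, liftElim (0 : ℝ≥0∞) w (α r) := rfl

/-! ### The statistical powerdomain `T` -/

/-- The randomisable random operators. -/
noncomputable def randomisable (X : OmegaQbs.{u}) : Set (ℝ → J X) :=
  {γ | ∃ A ∈ (R X).rand, γ = fun r => E X (A r)}

/-- The closure under lubs of the randomisable operators. -/
def TCarrier (X : OmegaQbs.{u}) : Type u := {μ : J X // OmegaLubClosure (Set.range (E X)) μ}

noncomputable instance (X : OmegaQbs.{u}) : OmegaCompletePartialOrder (TCarrier X) :=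
  OmegaCompletePartialOrder.subtype _ fun c h => OmegaLubClosure.lub c fun n => h _ ⟨n, rfl⟩

/-- The closure under pointwise lubs of the randomisable random operators. -/
def TRand (X : OmegaQbs.{u}) : Set (ℝ → TCarrier X) :=
  {β | OmegaLubClosure (randomisable X) fun r => (β r).1}

theorem closure_map {α : Type u} {β : Type v} [OmegaCompletePartialOrder α]
    [OmegaCompletePartialOrder β] {S : Set α} {S' : Set β} {F : α → β} (hF : ωScottContinuous F)
    (h : ∀ a ∈ S, OmegaLubClosure S' (F a)) {a : α} (ha : OmegaLubClosure S a) :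
    OmegaLubClosure S' (F a) := by
  induction ha with
  | basic a ha => exact h a ha
  | lub c _ ih =>
    rw [hF.map_ωSup]
    exact OmegaLubClosure.lub _ ih

theorem continuous_ite_fun (B : Set ℝ) [DecidablePred (· ∈ B)] :
    ωScottContinuous fun z : (ℝ → X) × (ℝ → X) => fun r => if r ∈ B then z.1 r else z.2 r := by
  refine ωScottContinuous.of_apply₂ fun r => ?_
  by_cases hr : r ∈ B <;> simp only [hr, if_true, if_false] <;> fun_prop

theorem closure_ite {S : Set (ℝ → X)} {B : Set ℝ} [DecidablePred (· ∈ B)]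
    (hS : ∀ a ∈ S, ∀ b ∈ S, (fun r => if r ∈ B then a r else b r) ∈ S) {a b : ℝ → X}
    (ha : OmegaLubClosure S a) (hb : OmegaLubClosure S b) :
    OmegaLubClosure S fun r => if r ∈ B then a r else b r := by
  refine closure_map (F := fun (a : ℝ → X) r => if r ∈ B then a r else b r)
    ((continuous_ite_fun B).comp (Prod.ωScottContinuous.prodMk ωScottContinuous.id
      ωScottContinuous.const)) (fun a ha => ?_) ha
  exact closure_map (F := fun (b : ℝ → X) r => if r ∈ B then a r else b r)
    ((continuous_ite_fun B).comp (Prod.ωScottContinuous.prodMk ωScottContinuous.const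
      ωScottContinuous.id)) (fun b hb => OmegaLubClosure.basic _ (hS a ha b hb)) hb

theorem randomisable_ite {B : Set ℝ} [DecidablePred (· ∈ B)] (hB : MeasurableSet B)
    (a : ℝ → J X) (ha : a ∈ randomisable X) (b : ℝ → J X) (hb : b ∈ randomisable X) :
    (fun r => if r ∈ B then a r else b r) ∈ randomisable X := by
  obtain ⟨A, hA, rfl⟩ := ha
  obtain ⟨A', hA', rfl⟩ := hb
  exact ⟨_, ite_mem (R X) hB hA hA', funext fun r => (apply_ite (E X) _ _ _).symm⟩

/-- The zero operator, the expectation of the nowhere defined randomisation. -/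
noncomputable def zeroOp (X : OmegaQbs.{u}) : J X := E X (const realQ (undef X) : Hom _ _)

theorem zeroOp_le (μ : J X) : zeroOp X ≤ μ := fun w =>
  le_of_eq_of_le (lintegral_zero : ∫⁻ _ : ℝ, (0 : ℝ≥0∞) = 0) (weight_zero_le (μ w))

theorem T_glue (p : ℝ → ℕ) (a : ℕ → ℝ → J X) (hp : Measurable p)
    (h : ∀ n, OmegaLubClosure (randomisable X) (a n)) :
    OmegaLubClosure (randomisable X) fun r => a (p r) r := by
  classical
  let g : ℕ → ℝ → J X := fun n r => if p r < n then a (p r) r else zeroOp X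
  have hg : ∀ n, OmegaLubClosure (randomisable X) (g n) := by
    intro n
    induction n with
    | zero =>
      refine OmegaLubClosure.basic _ ⟨_, (R X).const_mem (const realQ (undef X) : Hom _ _), ?_⟩
      funext r
      simp [g, zeroOp]
    | succ n ih =>
      have hm : MeasurableSet {r | p r = n} := hp (measurableSet_singleton n)
      have := closure_ite (randomisable_ite hm) (h n) ih
      convert this using 1
      funext r
      by_cases h1 : p r = n
      · simp [g, h1]
      · have : p r < n + 1 ↔ p r < n := by omega
        simp [g, h1, this]
  have hmono : Monotone g := fun i j hij r => by
    by_cases h1 : p r < i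
    · simp [g, h1, h1.trans_le hij]
    · simp only [g, h1, if_false]
      exact zeroOp_le _
  have := OmegaLubClosure.lub ⟨⟨g, hmono⟩⟩ hg
  convert this using 1
  refine le_antisymm (fun r => le_ωSup_of_le (p r + 1) ?_) (ωSup_le _ _ fun n r => ?_)
  · change a (p r) r ≤ g (p r + 1) r
    simp [g]
  · change g n r ≤ a (p r) r
    by_cases h1 : p r < n
    · simp [g, h1]
    · simp only [g, h1, if_false]
      exact zeroOp_le _

/-- The statistical powerdomain. -/
noncomputable def T (X : OmegaQbs.{u}) : OmegaQbs.{u} where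
  carrier := TCarrier X
  order := inferInstance
  rand := TRand X
  const_mem μ := by
    refine closure_map (F := fun (μ : J X) (_ : ℝ) => μ)
      (ωScottContinuous.of_apply₂ fun _ => ωScottContinuous.id) ?_ μ.2
    rintro _ ⟨α, rfl⟩
    exact OmegaLubClosure.basic _ ⟨_, (R X).const_mem α, rfl⟩
  comp_mem β h g hg := by
    refine closure_map (F := fun (a : ℝ → J X) r => a (g r))
      (ωScottContinuous.of_apply₂ fun r => ωScottContinuous.apply (g r)) ?_ h
    rintro _ ⟨A, hA, rfl⟩
    exact OmegaLubClosure.basic _ ⟨_, (R X).comp_mem A hA g hg, rfl⟩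
  glue_mem p β hp h := T_glue p (fun n r => (β n r).1) hp h
  lub_mem c h := OmegaLubClosure.lub
    (c.map ⟨fun β r => (β r).1, fun _ _ h r => h r⟩ : Chain (ℝ → J X)) h

/-- The inclusion `T X → J X`. -/
noncomputable def inclT (X : OmegaQbs.{u}) : Hom (T X) (J X) :=
  mkHom (fun μ => μ.1)
    (continuous_of_le (fun _ _ h => h) fun c b h => ωSup_le (α := J X) _ _ h)
    fun β hβ => by
      have hβ : OmegaLubClosure (randomisable X) fun r => (β r).1 := hβ
      generalize (fun r => (β r).1) = b at hβ
      induction hβ with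
      | basic a ha =>
        obtain ⟨A, hA, rfl⟩ := ha
        exact (E X).rand hA
      | lub c _ ih => exact (J X).lub_mem c ih

/-- The corestriction `R X → T X` of the expectation morphism. -/
noncomputable def toT (X : OmegaQbs.{u}) : Hom (R X) (T X) :=
  mkHom (fun α => (⟨E X α, OmegaLubClosure.basic _ ⟨α, rfl⟩⟩ : TCarrier X))
    (continuous_of_le (fun _ _ h => (E X).mono h) fun c b h =>
      le_of_continuous (E X).cont c b.1 h)
    fun A hA => OmegaLubClosure.basic _ ⟨A, hA, rfl⟩

/-! ### The factorisation system -/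

/-- Full monos: order-reflecting morphisms. -/
def IsFullMono (f : Hom X Y) : Prop := ∀ a b : X, f a ≤ f b → a ≤ b

/-- Densely strong epis: the images of the random elements of `X` are dense among the random
elements of `Y`, that is, their closure under pointwise lubs of `ω`-chains is the set of all random
elements of `Y`. -/
def IsDenselyStrongEpi (f : Hom X Y) : Prop :=
  ∀ β : ℝ → Y, β ∈ Y.rand ↔ OmegaLubClosure {γ | ∃ α ∈ X.rand, γ = fun r => f (α r)} β

end OmegaQbs

/-! The substantial point is that the bind of `J` stays inside `T`, for elements and for random
elements alike. Since bind is continuous, its first argument may be taken to be a randomisable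
family `E X (A r)`. The second argument `f` is a random element of an exponential, and nothing
presents it as a lub of randomisable families. Its composite with `A` is better behaved: `b r s = f
r (A r s)`, set to the zero operator where `A r s` is undefined, is a random element of `T Y` once
the plane is identified with the line, so it is generated by lubs from randomisable families. The
bind at `r` is the Lebesgue integral of `b r s` over `s`, so it suffices that integrating out one
variable preserves the closure (`closure_integral`, used in `closure_jBind`). Integration commutes
with lubs by monotone convergence; a randomisable family integrates to the expectation of a single
randomisation, which uses a transfer to draw both `s` and the seed of the `s`-th randomisation
(`lintegral_mixFun`).

Transfers exist because line and plane both split into countably many cells of mass one, and every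
probability measure on the plane is an image of the uniform distribution on the unit interval.

The rest is formal. The inclusions into `J` are injective, so uniqueness and the monad laws descend
from `J`, and preservation by `toT` reduces to preservation by `E`, which is change of variables and
Tonelli (`E_rBind`). Density of `toT` holds because each stage in the generation of a random element
of `T` already takes its values in `T`. -/

/-! ### Transfers of randomness from the line to the plane -/

/-- Lebesgue measure on the line can be pushed forward to Lebesgue measure on the plane. -/
theorem exists_measurable_map_volume_eq_volume_prod :
    ∃ ψ : ℝ → ℝ × ℝ, Measurable ψ ∧ volume.map ψ = (volume : Measure (ℝ × ℝ)) := by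
  -- Pairs the unit intervals of the line with the unit squares of the plane.
  let σ : ℤ ≃ ℤ × ℤ := (Denumerable.eqv ℤ).trans (Denumerable.eqv (ℤ × ℤ)).symm
  let cell : ℤ → Set (ℝ × ℝ) := fun n =>
    Set.Ico ((σ n).1 : ℝ) ((σ n).1 + 1) ×ˢ Set.Ico ((σ n).2 : ℝ) ((σ n).2 + 1)
  have hcell : ∀ n, MeasurableSet (cell n) := fun n => measurableSet_Ico.prod measurableSet_Ico
  have hmem : ∀ (n : ℤ) (p : ℝ × ℝ), p ∈ cell n ↔ (⌊p.1⌋, ⌊p.2⌋) = σ n := fun n p => by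
    simp only [cell, Set.mem_prod, ← Int.floor_eq_iff, Set.mem_Ico]
    rw [Prod.ext_iff]
  have hcover : ⋃ n, cell n = Set.univ := Set.eq_univ_of_forall fun p =>
    Set.mem_iUnion.2 ⟨σ.symm (⌊p.1⌋, ⌊p.2⌋), (hmem _ p).2 (by simp)⟩
  have hdisj : Pairwise (Function.onFun Disjoint cell) := fun m n hmn =>
    Set.disjoint_left.2 fun p hm hn =>
      hmn (σ.injective (((hmem m p).1 hm).symm.trans ((hmem n p).1 hn)))
  -- Each cell has area one, so restricted Lebesgue measure is a Markov kernel in the index; its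
  -- randomisation over the unit interval is jointly measurable.
  let κ : ProbabilityTheory.Kernel ℤ (ℝ × ℝ) :=
    ⟨fun n => volume.restrict (cell n), measurable_of_countable _⟩
  have : ProbabilityTheory.IsMarkovKernel κ := ⟨fun n => ⟨by
    change volume.restrict (cell n) Set.univ = 1
    simp [cell, Measure.volume_eq_prod]⟩⟩
  obtain ⟨f, hf, hκ⟩ := κ.exists_measurable_map_eq_unitInterval
  -- The integer part selects the square and the fractional part is the uniform seed inside it.
  let ψ : ℝ → ℝ × ℝ := fun r => f ⌊r⌋ (Set.projIcc 0 1 zero_le_one (Int.fract r))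
  have hproj : Measurable (Set.projIcc (0 : ℝ) 1 zero_le_one) := continuous_projIcc.measurable
  have hψ : Measurable ψ := hf.comp (Int.measurable_floor.prodMk (hproj.comp measurable_fract))
  refine ⟨ψ, hψ, Measure.ext fun A hA => ?_⟩
  have hfn : ∀ n, Measurable (f n) := fun n => hf.comp (measurable_const.prodMk measurable_id)
  have hpiece : ∀ n : ℤ, volume (ψ ⁻¹' A ∩ Set.Ico (n : ℝ) (n + 1)) = volume (A ∩ cell n) := by
    intro n
    let B : Set ℝ := (fun x => f n (Set.projIcc 0 1 zero_le_one x)) ⁻¹' A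
    have h1 : ψ ⁻¹' A ∩ Set.Ico (n : ℝ) (n + 1) = (fun x => x - (n : ℝ)) ⁻¹' (B ∩ Set.Ico 0 1) := by
      ext r
      have hr : r ∈ Set.Ico (n : ℝ) (n + 1) ↔ ⌊r⌋ = n := Int.floor_eq_iff.symm
      have hr' : r - n ∈ Set.Ico (0 : ℝ) 1 ↔ ⌊r⌋ = n := by
        rw [← hr, Set.mem_Ico, Set.mem_Ico]
        constructor <;> rintro ⟨h, h'⟩ <;> constructor <;> linarith
      simp only [Set.mem_inter_iff, Set.mem_preimage, hr, hr', B, ψ]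
      refine and_congr_left fun h => ?_
      rw [← h, Int.self_sub_floor]
    -- The fractional part lives on the half-open interval and the seed on the closed one; the
    -- endpoint is null.
    have h2 : volume (B ∩ Set.Ico 0 1) = volume (B ∩ Set.Icc 0 1) :=
      measure_congr ((ae_eq_refl B).inter Ico_ae_eq_Icc)
    have h3 : B ∩ Set.Icc 0 1 = Subtype.val '' (f n ⁻¹' A) := by
      ext x
      constructor
      · rintro ⟨hx, hI⟩
        refine ⟨⟨x, hI⟩, ?_, rfl⟩
        simpa only [B, Set.mem_preimage, Set.projIcc_of_mem _ hI] using hx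
      · rintro ⟨⟨x, hI⟩, hx, rfl⟩
        refine ⟨?_, hI⟩
        simpa only [B, Set.mem_preimage, Set.projIcc_of_mem _ hI] using hx
    simp only [sub_eq_add_neg] at h1
    rw [h1, measure_preimage_add_right, h2, h3, ← unitInterval.volume_apply,
      ← Measure.map_apply (hfn n) hA, hκ]
    exact Measure.restrict_apply hA
  -- Both sides are summed over their countable partitions and compared cell by cell.
  rw [Measure.map_apply hψ hA, ← Set.inter_univ (ψ ⁻¹' A), ← iUnion_Ico_intCast, Set.inter_iUnion,
    measure_iUnion, tsum_congr hpiece, ← measure_iUnion, ← Set.inter_iUnion, hcover, Set.inter_univ]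
  · exact fun i j h => (hdisj h).mono Set.inter_subset_right Set.inter_subset_right
  · exact fun n => hA.inter (hcell n)
  · exact fun i j h => ((Set.pairwise_disjoint_Ico_intCast ℝ) h).mono
      Set.inter_subset_right Set.inter_subset_right
  · exact fun n => (hψ hA).inter measurableSet_Ico

namespace OmegaQbs
variable {X : OmegaQbs.{u}} {Y : OmegaQbs.{v}} {Z : OmegaQbs.{w}}

theorem continuous_of_real {f : realQ → Y} : ωScottContinuous f :=
  continuous_of_le (fun x y h => by
    have h : x = y := h
    rw [h]) fun _ _ h => h 0

/-- A random element, as a morphism out of the space of real values. -/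
def homOfRand (α : ℝ → Y) (h : α ∈ Y.rand) : Hom realQ Y :=
  mkHom (fun r => α r) continuous_of_real fun g hg => Y.comp_mem α h g hg

theorem exists_isTransfer : ∃ φ : Hom realQ (lift (prod realQ realQ)), IsTransfer φ := by
  obtain ⟨ψ, hψ, hmap⟩ := exists_measurable_map_volume_eq_volume_prod
  refine ⟨homOfRand (Y := lift (prod realQ realQ))
    (fun r => defined (X := prod realQ realQ) (ψ r)) (mem_liftRand.2 ⟨?_, fun x => ?_⟩), fun A hA => ?_⟩
  · convert MeasurableSet.univ using 1
    exact Set.eq_univ_of_forall fun r => WithBot.coe_ne_bot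
  · exact ⟨measurable_fst.comp hψ, measurable_snd.comp hψ⟩
  · rw [← hmap, Measure.map_apply hψ hA]
    congr 1
    ext r
    constructor
    · rintro ⟨p, hp, h⟩
      have h : ψ r = p := WithBot.coe_injective h
      exact (congrArg (· ∈ A) h).mpr hp
    · exact fun h => ⟨ψ r, h, rfl⟩

/-- Integration along a transfer of randomness is integration over the plane. -/
theorem lintegral_transfer {φ : Hom realQ (lift (prod realQ realQ))} (hφ : IsTransfer φ)
    {g : ℝ × ℝ → ℝ≥0∞} (hg : Measurable g) :
    ∫⁻ r : ℝ, liftElim (0 : ℝ≥0∞) g (φ r) = ∫⁻ p, g p := by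
  have hrand := mem_liftRand.1 (φ.rand (α := fun r => r) measurable_id)
  let D : Set ℝ := {r | φ r ≠ (⊥ : WithBot (ℝ × ℝ))}
  have hD : MeasurableSet D := hrand.1
  -- The default value off `D` is immaterial: only Lebesgue measure restricted to `D` is pushed
  -- forward.
  let ψ : ℝ → ℝ × ℝ := fun r => liftElim ((0, 0) : ℝ × ℝ) (fun p => p) (φ r)
  have hψ : Measurable ψ := Measurable.prodMk (hrand.2 ((0, 0) : ℝ × ℝ)).1 (hrand.2 ((0, 0) : ℝ × ℝ)).2
  have hcases : ∀ r, φ r = (⊥ : WithBot (ℝ × ℝ)) ∨ φ r = defined (X := prod realQ realQ) (ψ r) := by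
    intro r
    simp only [ψ]
    generalize φ r = y
    cases y with
    | none => exact Or.inl rfl
    | some p => exact Or.inr rfl
  have hmap : (volume.restrict D).map ψ = volume := Measure.ext fun A hA => by
    rw [Measure.map_apply hψ hA, Measure.restrict_apply (hψ hA), ← hφ A hA]
    congr 1
    ext r
    constructor
    · rintro ⟨h1, h2⟩
      exact ⟨ψ r, h1, (hcases r).resolve_left h2⟩
    · rintro ⟨p, hp, h⟩
      have hp' : ψ r = p := congrArg (liftElim ((0, 0) : ℝ × ℝ) (fun p => p)) h
      refine ⟨(congrArg (· ∈ A) hp').mpr hp, fun h' => ?_⟩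
      exact WithBot.coe_ne_bot (h.symm.trans h')
  rw [← hmap, lintegral_map hg hψ, ← lintegral_indicator hD]
  refine lintegral_congr fun r => ?_
  by_cases hr : r ∈ D
  · rw [Set.indicator_of_mem hr]
    exact congrArg (liftElim 0 g) ((hcases r).resolve_left hr)
  · rw [Set.indicator_of_notMem hr]
    exact congrArg (liftElim 0 g) (not_not.1 hr)

/-! ### The factorisation of the expectation morphism -/

theorem closure_apply {S : Set (ℝ → X)} {S' : Set X} (h : ∀ a ∈ S, ∀ r, a r ∈ S') {a : ℝ → X}
    (ha : OmegaLubClosure S a) (r : ℝ) : OmegaLubClosure S' (a r) :=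
  closure_map (F := fun a : ℝ → X => a r) (ωScottContinuous.apply r)
    (fun a ha => OmegaLubClosure.basic _ (h a ha r)) ha

/-- Evaluation at a point is continuous, so a generation of the whole family yields one of each
value. This lets intermediate stages be regarded as `T`-valued. -/
theorem closure_range_of_closure_randomisable {b : ℝ → J X}
    (hb : OmegaLubClosure (randomisable X) b) (r : ℝ) :
    OmegaLubClosure (Set.range (E X)) (b r) :=
  closure_apply (X := J X) (by rintro _ ⟨A, -, rfl⟩ r; exact ⟨A r, rfl⟩) hb r

theorem mem_rand_of_closure_randomisable {b : ℝ → J X}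
    (hb : OmegaLubClosure (randomisable X) b) : b ∈ (J X).rand := by
  induction hb with
  | basic a ha =>
    obtain ⟨A, hA, rfl⟩ := ha
    exact (E X).rand hA
  | lub c _ ih => exact (J X).lub_mem c ih

theorem inclT_injective (X : OmegaQbs.{u}) : Function.Injective (inclT X) :=
  fun _ _ h => Subtype.ext h

theorem isFullMono_inclT (X : OmegaQbs.{u}) : IsFullMono (inclT X) := fun _ _ h => h

/-- The two closures are formed in different spaces: `M_{TX}` among `J`-valued functions, density
among `T`-valued ones. They agree because every stage of the former lifts along the order-reflecting
inclusion. -/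
theorem isDenselyStrongEpi_toT (X : OmegaQbs.{u}) : IsDenselyStrongEpi (toT X) := by
  intro β
  constructor
  · intro hβ
    -- The induction runs over the `J`-valued function, so its `T`-valued lift has to be quantified
    -- inside.
    suffices h : ∀ b : ℝ → J X, OmegaLubClosure (randomisable X) b →
        ∀ β : ℝ → T X, (∀ r, inclT X (β r) = b r) →
        OmegaLubClosure {γ | ∃ α ∈ (R X).rand, γ = fun r => toT X (α r)} β from
      h _ hβ β fun _ => rfl
    intro b hb
    induction hb with
    | basic b hb =>
      obtain ⟨A, hA, rfl⟩ := hb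
      exact fun β h => OmegaLubClosure.basic _
        ⟨A, hA, funext fun r => inclT_injective X (h r)⟩
    | lub c hc ih =>
      intro β h
      let d : Chain (ℝ → T X) := ⟨⟨fun n r =>
        (⟨c n r, closure_range_of_closure_randomisable (hc n) r⟩ : TCarrier X),
        fun i j hij r => c.monotone hij r⟩⟩
      have : β = ωSup d := funext fun r => inclT_injective X (h r)
      rw [this]
      exact OmegaLubClosure.lub d fun n => ih n (d n) fun _ => rfl
  · exact fun h => closure_map
      (F := fun (β : ℝ → T X) r => inclT X (β r))
      (ωScottContinuous.of_apply₂ fun r => (inclT X).cont.comp (ωScottContinuous.apply r))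
      (by
        rintro _ ⟨A, hA, rfl⟩
        exact OmegaLubClosure.basic _ ⟨A, hA, rfl⟩) h

/-! ### Integration of random operators -/

/-- Integration against the Lebesgue measure. -/
noncomputable def lebesgue : Hom (exp realQ weight) weight :=
  -- As the expectation of the total identity randomisation, integration is a morphism at no further
  -- cost.
  E realQ (mkHom defined (continuous_coe realQ)
    fun _ h => mem_liftRand.2 ⟨by simp [defined], fun _ => h⟩ : Hom realQ (lift realQ))

/-- The Lebesgue integral of a family of operators. -/
noncomputable def integral (Y : OmegaQbs.{u}) : Hom (exp realQ (J Y)) (J Y) :=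
  let A := prod (exp realQ (J Y)) (exp Y weight)
  let inner : Hom (prod A realQ) weight :=
    comp (eval (exp Y weight) weight)
      (pair (comp (eval realQ (J Y)) (pair (comp (fst _ _) (fst A realQ)) (snd A realQ)))
        (comp (snd _ _) (fst A realQ)))
  curry (comp lebesgue (curry inner))

/-- A Borel isomorphism between the line and the plane. -/
noncomputable def realEquivProd : ℝ ≃ᵐ ℝ × ℝ :=
  PolishSpace.measurableEquivOfNotCountable not_countable not_countable

/-- Random elements are indexed by the line only; a Borel isomorphism turns their closure properties
into joint measurability on the plane. -/
theorem measurable_of_rand_comp_realEquivProd {g : ℝ × ℝ → ℝ≥0∞}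
    (h : (fun r => g (realEquivProd r)) ∈ weight.rand) : Measurable g := by
  have h : Measurable fun r => g (realEquivProd r) := h
  have := h.comp realEquivProd.symm.measurable
  simpa [Function.comp_def] using this

theorem slice_mem {b : ℝ → Y} (hb : b ∈ Y.rand) (r : ℝ) :
    (fun s => b (realEquivProd.symm (r, s))) ∈ Y.rand :=
  Y.comp_mem b hb _ (realEquivProd.symm.measurable.comp (measurable_const.prodMk measurable_id))

/-- Run the randomisations `B s`, `s : ℝ`, on a randomly chosen `s`, where `φ` supplies both `s` and
the source of randomness of `B s`. -/
noncomputable def mixFun (φ : Hom realQ (lift (prod realQ realQ))) (B : ℝ → R Y) (u : ℝ) : lift Y :=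
  liftElim (undef Y) (fun st : ℝ × ℝ => B st.1 st.2) (φ u)

/-- A constant `g` makes each mixture a randomisation; a general `g` makes the mixtures a random
element of `R Y`. -/
theorem mixFun_mem (φ : Hom realQ (lift (prod realQ realQ))) {B : ℝ → ℝ → R Y}
    (hB : (fun q => B (realEquivProd q).1 (realEquivProd q).2) ∈ (R Y).rand) {g g' : ℝ → ℝ}
    (hg : Measurable g) (hg' : Measurable g') :
    (fun r => mixFun φ (B (g r)) (g' r)) ∈ (lift Y).rand := by
  refine liftElim_mem (X := prod realQ realQ) (Y := lift Y) (fun p hp => ?_) (φ.rand hg')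
  -- The parameter and the first component drawn by `φ` are coded as one real, which reindexes `hB`.
  have := mem_exp_rand.1 hB (fun r => realEquivProd.symm (g r, (p r).1))
    (realEquivProd.symm.measurable.comp (hg.prodMk hp.1)) _ hp.2
  simp only [MeasurableEquiv.apply_symm_apply] at this
  exact this

/-- The transfer turns the left side into an integral over the plane, and Tonelli splits off the
seed. -/
theorem lintegral_mixFun {φ : Hom realQ (lift (prod realQ realQ))} (hφ : IsTransfer φ)
    {B : ℝ → R Y} (hB : B ∈ (R Y).rand) (w : exp Y weight) :
    ∫⁻ u : ℝ, liftElim (0 : ℝ≥0∞) w (mixFun φ B u) = ∫⁻ s : ℝ, E Y (B s) w := by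
  have hm := measurable_integrand hB ((exp Y weight).const_mem w)
  refine Eq.trans ?_ ((lintegral_transfer hφ hm).trans (lintegral_prod _ hm.aemeasurable))
  refine lintegral_congr fun u => ?_
  unfold mixFun
  generalize φ u = y
  cases y <;> rfl

/-- Induction on the generation of `b`: randomisable families integrate to expectations of mixtures,
and integration is continuous. The bundled slices `H` vary with the stage, hence are generalised. -/
theorem closure_integral {b : ℝ → J Y} (hb : OmegaLubClosure (randomisable Y) b)
    (H : ℝ → exp realQ (J Y)) (hH : ∀ r s : ℝ, H r s = b (realEquivProd.symm (r, s))) :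
    OmegaLubClosure (randomisable Y) fun r => integral Y (H r) := by
  induction hb generalizing H with
  | basic b hb =>
    obtain ⟨B, hB, rfl⟩ := hb
    -- Any transfer serves here; the conclusion does not depend on it.
    obtain ⟨φ, hφ⟩ := exists_isTransfer
    let B' : ℝ → ℝ → R Y := fun r s => B (realEquivProd.symm (r, s))
    have hB' : (fun q => B' (realEquivProd q).1 (realEquivProd q).2) ∈ (R Y).rand := by
      simpa [B'] using hB
    refine OmegaLubClosure.basic _ ⟨fun r => homOfRand (mixFun φ (B' r))
      (mixFun_mem φ hB' measurable_const measurable_id), mem_exp_rand.2 fun g hg g' hg' =>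
        mixFun_mem φ hB' hg hg', funext fun r => Hom.ext fun w => ?_⟩
    refine Eq.trans ?_ (lintegral_mixFun hφ (slice_mem hB r) w).symm
    exact lintegral_congr fun s => congrArg (fun μ : J Y => μ w) (hH r s)
  | lub c hc ih =>
    -- Each stage is a random element of `J Y`, so its slices are again morphisms out of the reals.
    let d : Chain (ℝ → exp realQ (J Y)) := ⟨⟨fun n r =>
      homOfRand _ (slice_mem (mem_rand_of_closure_randomisable (hc n)) r),
      fun i j hij r s => c.monotone hij _⟩⟩
    have hd : H = ωSup d := funext fun r => Hom.ext fun s => hH r s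
    have hG : ωScottContinuous fun (H : ℝ → exp realQ (J Y)) r => integral Y (H r) :=
      ωScottContinuous.of_apply₂ fun r => (integral Y).cont.comp (ωScottContinuous.apply r)
    have := hG.map_ωSup d
    rw [← hd] at this
    rw [this]
    exact OmegaLubClosure.lub _ fun n => ih n (d n) fun _ _ => rfl

/-! ### The monad structure of the statistical powerdomain -/

/-- Only `a` is reduced to generators. For a randomisable `a` the bind is an integral of operators,
and the integrand is a random element of `T Y`, whatever `f` is. -/
theorem closure_jBind {X Y : OmegaQbs.{u}} {a : ℝ → J X} (ha : OmegaLubClosure (randomisable X) a)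
    {f : ℝ → exp X (T Y)} (hf : f ∈ (exp X (T Y)).rand) :
    OmegaLubClosure (randomisable Y) fun r => jBind X Y (a r, comp (inclT Y) (f r)) := by
  have hF : ωScottContinuous fun (a : ℝ → J X) r => jBind X Y (a r, comp (inclT Y) (f r)) :=
    ωScottContinuous.of_apply₂ fun r => (jBind X Y).cont.comp
      (Prod.ωScottContinuous.prodMk (ωScottContinuous.apply r) ωScottContinuous.const)
  refine closure_map hF ?_ ha
  rintro _ ⟨A, hA, rfl⟩
  -- The expectation of the nowhere defined randomisation: it contributes nothing to the integral,
  -- just like the points where `A r` is undefined.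
  let zero : T Y := toT Y (const realQ (undef Y) : Hom _ _)
  let b : ℝ → ℝ → T Y := fun r s => liftElim zero (f r) (A r s)
  let e := realEquivProd
  have h1 : Measurable fun q => (e q).1 := measurable_fst.comp e.measurable
  have h2 : Measurable fun q => (e q).2 := measurable_snd.comp e.measurable
  have hb : (fun q => b (e q).1 (e q).2) ∈ (T Y).rand :=
    liftElim_mem (X := X) (Y := T Y) (fun α hα => mem_exp_rand.1 hf _ h1 α hα)
      (mem_exp_rand.1 hA _ h1 _ h2)
  have hslice : ∀ r, b r ∈ (T Y).rand := fun r => by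
    simpa [e] using slice_mem hb r
  have := closure_integral (b := fun q => inclT Y (b (e q).1 (e q).2)) hb
    (fun r => comp (inclT Y) (homOfRand (b r) (hslice r))) fun r s => by
      simp only [e, MeasurableEquiv.apply_symm_apply]
      rfl
  convert this using 1
  funext r
  refine Hom.ext fun w => lintegral_congr fun s => ?_
  change liftElim (0 : ℝ≥0∞) _ (A r s) = inclT Y (liftElim zero (f r) (A r s)) w
  generalize A r s = y
  cases y with
  | bot => exact (lintegral_zero : ∫⁻ _ : ℝ, (0 : ℝ≥0∞) = 0).symm
  | coe x => rfl

theorem closure_jBind_apply {X Y : OmegaQbs.{u}} (a : T X) (f : exp X (T Y)) :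
    OmegaLubClosure (Set.range (E Y)) (jBind X Y (inclT X a, comp (inclT Y) f)) :=
  closure_range_of_closure_randomisable
    (closure_jBind ((T X).const_mem a) ((exp X (T Y)).const_mem f)) 0

theorem continuous_comp_left (g : Hom Y Z) :
    ωScottContinuous fun f : exp X Y => (comp g f : exp X Z) :=
  continuous_exp fun _ => g.cont.comp
    (continuous_apply (X := X) (Y := Y) ωScottContinuous.id ωScottContinuous.const)

/-- The bind of `T`, the restriction of the bind of `J`. -/
noncomputable def tBind (X Y : OmegaQbs.{u}) : Hom (prod (T X) (exp X (T Y))) (T Y) :=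
  have hc : ωScottContinuous fun z : prod (T X) (exp X (T Y)) =>
      jBind X Y (inclT X z.1, comp (inclT Y) z.2) :=
    (jBind X Y).cont.comp (Prod.ωScottContinuous.prodMk
      ((inclT X).cont.comp Prod.ωScottContinuous_fst)
      ((continuous_comp_left (inclT Y)).comp Prod.ωScottContinuous_snd))
  mkHom (fun z => (⟨jBind X Y (inclT X z.1, comp (inclT Y) z.2),
      closure_jBind_apply z.1 z.2⟩ : TCarrier Y))
    (continuous_of_le (fun _ _ h => hc.monotone h) fun c b h => le_of_continuous hc c b.1 h)
    fun _ hγ => closure_jBind hγ.1 hγ.2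

/-- The statistical powerdomain monad. -/
noncomputable def tMonad : StrongMonadStr T.{u} where
  -- Through `rRet` the unit visibly lands in `T`, and `toT` preserves it by definition.
  ret X := comp (toT X) (rRet X)
  bind := tBind

theorem inclT_tBind {X Y : OmegaQbs.{u}} (a : T X) (f : Hom X (T Y)) :
    inclT Y (tBind X Y (a, f)) = jBind X Y (inclT X a, comp (inclT Y) f) := rfl

/-! ### Expectations of the unit and bind of randomisations -/

/-- The domain `[0, 1]` of the unit has length one. -/
theorem E_rRet (x : X) : E X (rRet X x) = jRet X x := by
  refine Hom.ext fun w => ?_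
  let y : ℝ≥0∞ := w x
  change ∫⁻ r : ℝ, liftElim (0 : ℝ≥0∞) w (rRet X x r) = y
  have : ∀ r : ℝ, liftElim (0 : ℝ≥0∞) w (rRet X x r) =
      (Set.Icc (0 : ℝ) 1).indicator (fun _ => y) r := fun r => by
    by_cases hr : r ∈ Set.Icc (0 : ℝ) 1
    · rw [rRet_apply_of_mem X x hr, Set.indicator_of_mem hr]
      rfl
    · rw [rRet_apply_of_notMem X x hr, Set.indicator_of_notMem hr]
      rfl
  rw [lintegral_congr this, lintegral_indicator measurableSet_Icc, setLIntegral_const]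
  simp

/-- After the change of variables along `φ`, both sides are iterated integrals of `w (f (α t) s)`,
with undefined points counting as zero. -/
theorem E_rBind {φ : Hom realQ (lift (prod realQ realQ))} (hφ : IsTransfer φ) {X Y : OmegaQbs.{u}}
    (α : R X) (f : exp X (R Y)) :
    E Y (rBind φ X Y (α, f)) = jBind X Y (E X α, comp (E Y) f) := by
  refine Hom.ext fun w => ?_
  let g : ℝ × ℝ → ℝ≥0∞ := fun st =>
    liftElim (0 : ℝ≥0∞) (fun x => liftElim (0 : ℝ≥0∞) w (f x st.1)) (α st.2)
  have hg : Measurable g := by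
    refine measurable_of_rand_comp_realEquivProd ?_
    have h1 : Measurable fun q => (realEquivProd q).1 :=
      measurable_fst.comp realEquivProd.measurable
    have h2 : Measurable fun q => (realEquivProd q).2 :=
      measurable_snd.comp realEquivProd.measurable
    refine liftElim_mem (X := X) (Y := weight) (fun β hβ => ?_) (Hom.rand (α : Hom _ _) h2)
    refine liftElim_mem (X := Y) (Y := weight) (fun β hβ => Hom.rand (w : Hom _ _) hβ) ?_
    exact exp_rand_apply (X := realQ) (Y := lift Y) (Hom.rand (f : Hom _ _) hβ) h1
  have h1 : ∫⁻ r : ℝ, liftElim (0 : ℝ≥0∞) w (rBind φ X Y (α, f) r) =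
      ∫⁻ r : ℝ, liftElim (0 : ℝ≥0∞) g (φ r) := lintegral_congr fun r => by
    rw [rBind_apply]
    generalize φ r = y
    cases y with
    | none => rfl
    | some st =>
      change liftElim (0 : ℝ≥0∞) w (liftElim ⊥ (fun x => f x st.1) (α st.2)) =
        liftElim (0 : ℝ≥0∞) (fun x => liftElim (0 : ℝ≥0∞) w (f x st.1)) (α st.2)
      generalize α st.2 = z
      cases z <;> rfl
  -- The symmetric form of Tonelli puts the seed `s` of the continuation inside, so the inner
  -- integral is its expectation.
  have h2 := h1.trans ((lintegral_transfer hφ hg).trans (lintegral_prod_symm _ hg.aemeasurable))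
  refine h2.trans (lintegral_congr fun t => ?_)
  change ∫⁻ s : ℝ, liftElim (0 : ℝ≥0∞) (fun x => liftElim (0 : ℝ≥0∞) w (f x s)) (α t) =
    liftElim (0 : ℝ≥0∞) (fun x => E Y (f x) w) (α t)
  generalize α t = z
  cases z with
  | bot => exact lintegral_zero
  | coe x => rfl

/-! ### Preservation, uniqueness and the monad laws -/

theorem preservesMonadStr_inclT : PreservesMonadStr tMonad.{u} jMonad inclT where
  map_ret _ x := E_rRet x
  map_bind _ _ a f := inclT_tBind a f

theorem preservesMonadStr_toT {φ : Hom realQ (lift (prod realQ realQ))} (hφ : IsTransfer φ) :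
    PreservesMonadStr (rMonad.{u} φ) tMonad toT where
  map_ret _ _ := rfl
  map_bind _ Y α f := inclT_injective Y (E_rBind hφ α f)

theorem eq_tMonad_of_preservesMonadStr {M : StrongMonadStr T.{u}}
    (h : PreservesMonadStr M jMonad inclT) : M = tMonad := by
  obtain ⟨ret, bind⟩ := M
  have h1 : ret = tMonad.ret := funext fun X => Hom.ext fun x =>
    inclT_injective X ((h.map_ret X x).trans (preservesMonadStr_inclT.map_ret X x).symm)
  have h2 : bind = tMonad.bind := funext fun X => funext fun Y => Hom.ext fun z =>
    inclT_injective Y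
      ((h.map_bind X Y z.1 z.2).trans (preservesMonadStr_inclT.map_bind X Y z.1 z.2).symm)
  subst h1 h2
  rfl

/-- For a continuation monad the laws are instances of beta and eta. -/
theorem isStrongMonad_jMonad : jMonad.{u}.IsStrongMonad where
  ret_bind _ _ _ _ := rfl
  bind_ret _ _ := rfl
  bind_assoc _ _ _ _ _ _ := rfl

/-- A structure that embeds into a strong monad is a strong monad. -/
theorem StrongMonadStr.IsStrongMonad.of_injective {S S' : OmegaQbs.{u} → OmegaQbs.{u}}
    {M : StrongMonadStr S} {N : StrongMonadStr S'} {h : ∀ X, Hom (S X) (S' X)}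
    (hN : N.IsStrongMonad) (hh : PreservesMonadStr M N h) (hi : ∀ X, Function.Injective (h X)) :
    M.IsStrongMonad where
  ret_bind X Y x f := hi Y <| by
    rw [hh.map_bind, hh.map_ret, hN.ret_bind]
    rfl
  bind_ret X a := hi X <| by
    have : comp (h X) (M.ret X) = N.ret X := Hom.ext fun x => hh.map_ret X x
    rw [hh.map_bind, this, hN.bind_ret]
  bind_assoc X Y Z a f g := hi Z <| by
    rw [hh.map_bind, hh.map_bind, hh.map_bind, hN.bind_assoc]
    -- The two sides now differ only in the continuation, where preservation of bind applies
    -- pointwise.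
    congr 2
    exact Hom.ext fun x => (hh.map_bind Y Z (f x) g).symm

end OmegaQbs

open OmegaQbs in
theorem mainTheorem4 :
    (∀ X : OmegaQbs.{u},
      IsDenselyStrongEpi (toT X) ∧ IsFullMono (inclT X) ∧ comp (inclT X) (toT X) = E X) ∧
    (∃ φ : Hom realQ (lift (prod realQ realQ)), IsTransfer φ) ∧
    ∃ tMonad : StrongMonadStr T.{u},
      PreservesMonadStr tMonad jMonad inclT ∧
      (∀ tMonad' : StrongMonadStr T.{u},
        PreservesMonadStr tMonad' jMonad inclT → tMonad' = tMonad) ∧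
      tMonad.IsStrongMonad ∧
      (∀ φ : Hom realQ (lift (prod realQ realQ)), IsTransfer φ →
        PreservesMonadStr (rMonad φ) tMonad toT) := by
  exact ⟨fun X => ⟨isDenselyStrongEpi_toT X, isFullMono_inclT X, rfl⟩, exists_isTransfer, tMonad,
    preservesMonadStr_inclT, fun _ h => eq_tMonad_of_preservesMonadStr h,
    isStrongMonad_jMonad.of_injective preservesMonadStr_inclT inclT_injective,
    fun _ hφ => preservesMonadStr_toT hφ⟩
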